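/- For an even integer $k\ge 4$ and $\tau$ in the complex upper half-plane $\mathbb{H}$, let $$G_k(\tau)=\sum_{(a,b)\in\mathbb{Z}^2\setminus\{(0,0)\}}(a\tau+b)^{-k}$$ be the Eisenstein series of weight $k$. Then, for all integers $n\ge 2$ and all $\tau\in\mathbb{H}$, $$\binom{6n+1}{2n}G_{6n}(\tau)=\sum_{k=1}^{n}\left[\binom{2n+2k-1}{2n}\binom{4n-2k-1}{2n}+2\binom{2n+2k-1}{2n}\binom{4n-2k-1}{2n-2}\right]G_{2n+2k}(\tau)\,G_{4n-2k}(\tau).$$ -/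

import Mathlib

open scoped UpperHalfPlane

/-- The Eisenstein series `G_k(τ) = ∑ (mτ + n)^(-k)` of weight `k`, the sum running over all pairs
`(m, n) ∈ ℤ² ∖ {(0, 0)}`. The sum is unconditional, so this is the intended object for `3 ≤ k`, where the
series converges absolutely (see `summable_eisensteinG`). -/
noncomputable def eisensteinG (k : ℕ) (τ : ℍ) : ℂ :=
  ∑' v : {v : ℤ × ℤ // v ≠ (0, 0)}, ((v.1.1 : ℂ) * (τ : ℂ) + (v.1.2 : ℂ)) ^ (-(k : ℤ))

/-- The series defining `eisensteinG k τ` is absolutely convergent for `3 ≤ k`. -/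
theorem summable_eisensteinG (k : ℕ) (hk : 3 ≤ k) (τ : ℍ) :
    Summable fun v : {v : ℤ × ℤ // v ≠ (0, 0)} =>
      ‖((v.1.1 : ℂ) * (τ : ℂ) + (v.1.2 : ℂ)) ^ (-(k : ℤ))‖ := by
  have h := EisensteinSeries.summable_norm_eisSummand (k := (k : ℤ)) (by exact_mod_cast hk) τ
  have h2 := (finTwoArrowEquiv ℤ).symm.summable_iff.mpr h
  have h3 := h2.subtype {v : ℤ × ℤ | v ≠ (0, 0)}
  refine h3.congr ?_
  intro v
  simp [EisensteinSeries.eisSummand, finTwoArrowEquiv]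

open scoped LaurentSeries PowerSeries

open HahnSeries (single)

/-! ### Formal differentiation and residues of Laurent series -/

namespace LaurentSeries

/-! For a lattice, put `E_s(X) = ∑ (X + l)^(-s)`. For odd `s ≥ 3` this is, up to a constant, an
odd-order derivative of `℘`. Weierstrass's equation makes `℘'^2` and `℘''` polynomials in `℘`, so
`E_s = p(℘) ℘'`. A product of three such series is `q(℘) ℘'^3`, again of the form `r(℘) ℘'`, an
exact derivative; its residue at `0` vanishes (`residue_latticeExpansion_mul`).

The identity is this vanishing for `E_(2n+1)^2 E_(2n-1)`. Each factor is a pole plus a power series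
with lattice sums as coefficients. Two poles times a regular part give multiples of `G_(6n)`, and
one pole times two regular parts gives the quadratic sum (`coeff_single_add_sq_mul_single_add`).

The calculation is in formal Laurent series; analysis enters only in transferring Weierstrass's
equation to the expansion of `℘` (`derivative_latticeExpansion_sq`). -/

theorem coeff_derivative (f : ℂ⸨X⸩) (n : ℤ) :
    (derivative ℂ f).coeff n = (n + 1) * f.coeff (n + 1) := by
  simp

theorem derivative_single_mul (m : ℤ) (f : ℂ⸨X⸩) :
    derivative ℂ (single m 1 * f) =
      single (m - 1) (m : ℂ) * f + single m 1 * derivative ℂ f := by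
  ext n
  rw [coeff_derivative, HahnSeries.coeff_add, HahnSeries.coeff_single_mul,
    HahnSeries.coeff_single_mul, HahnSeries.coeff_single_mul, coeff_derivative,
    show n - (m - 1) = n + 1 - m by ring, show n - m + 1 = n + 1 - m by ring]
  push_cast
  ring

theorem derivative_coe (f : ℂ⟦X⟧) :
    derivative ℂ (f : ℂ⸨X⸩) = ((PowerSeries.derivative ℂ f : ℂ⟦X⟧) : ℂ⸨X⸩) := by
  ext n
  rw [coeff_derivative]
  obtain hn | rfl | hn := lt_trichotomy n (-1)
  · rw [PowerSeries.coeff_coe, PowerSeries.coeff_coe, if_pos (by lia), if_pos (by lia), mul_zero]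
  · rw [PowerSeries.coeff_coe, PowerSeries.coeff_coe, if_pos (by decide : (-1 : ℤ) < 0)]
    simp
  · lift n to ℕ using by lia
    have : (n : ℤ) + 1 = ((n + 1 : ℕ) : ℤ) := by push_cast; rfl
    rw [this, coeff_coe_powerSeries, coeff_coe_powerSeries, PowerSeries.coeff_derivative]
    push_cast
    ring

/-- Writing each factor as a power of `X` times a power series reduces this to the Leibniz rule for
power series. -/
theorem derivative_mul (f g : ℂ⸨X⸩) :
    derivative ℂ (f * g) = f * derivative ℂ g + g * derivative ℂ f := by
  obtain ⟨a, F, rfl⟩ : ∃ (a : ℤ) (F : ℂ⟦X⟧), single a 1 * (F : ℂ⸨X⸩) = f :=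
    ⟨_, _, single_order_mul_powerSeriesPart f⟩
  obtain ⟨b, G, rfl⟩ : ∃ (b : ℤ) (G : ℂ⟦X⟧), single b 1 * (G : ℂ⸨X⸩) = g :=
    ⟨_, _, single_order_mul_powerSeriesPart g⟩
  have h1 : (single a 1 * (F : ℂ⸨X⸩)) * (single b 1 * (G : ℂ⸨X⸩)) =
      single (a + b) 1 * ((F * G : ℂ⟦X⟧) : ℂ⸨X⸩) := by
    rw [PowerSeries.coe_mul, mul_mul_mul_comm, HahnSeries.single_mul_single, one_mul]
  have h2 : (single (a + b - 1) ((a + b : ℤ) : ℂ) : ℂ⸨X⸩) =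
      single (a - 1) (a : ℂ) * single b 1 + single a 1 * single (b - 1) (b : ℂ) := by
    rw [HahnSeries.single_mul_single, HahnSeries.single_mul_single,
      show a - 1 + b = a + b - 1 by ring, show a + (b - 1) = a + b - 1 by ring,
      ← HahnSeries.single_add]
    simp
  have h3 : (single (a + b) 1 : ℂ⸨X⸩) = single a 1 * single b 1 := by
    rw [HahnSeries.single_mul_single, one_mul]
  rw [h1, derivative_single_mul, derivative_single_mul, derivative_single_mul, derivative_coe,
    derivative_coe, derivative_coe, Derivation.leibniz, h2, h3]
  simp only [smul_eq_mul, PowerSeries.coe_add, PowerSeries.coe_mul]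
  ring

theorem coeff_C_mul (a : ℂ) (f : ℂ⸨X⸩) (n : ℤ) :
    (HahnSeries.C a * f).coeff n = a * f.coeff n := by
  rw [HahnSeries.C_apply, HahnSeries.coeff_single_mul, sub_zero]

theorem derivative_C_mul (a : ℂ) (f : ℂ⸨X⸩) :
    derivative ℂ (HahnSeries.C a * f) = HahnSeries.C a * derivative ℂ f := by
  ext n
  rw [coeff_derivative, coeff_C_mul, coeff_C_mul, coeff_derivative]
  ring

theorem derivative_pow (f : ℂ⸨X⸩) (n : ℕ) :
    derivative ℂ (f ^ n) = n * f ^ (n - 1) * derivative ℂ f := by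
  induction n with
  | zero =>
    ext m
    rw [coeff_derivative, pow_zero, HahnSeries.coeff_one]
    split_ifs with h
    · have : (m : ℂ) + 1 = 0 := by exact_mod_cast h
      simp [this]
    · simp
  | succ n ih =>
    rw [pow_succ, derivative_mul, ih]
    rcases n with _ | n
    · simp
    · simp only [Nat.add_sub_cancel, Nat.cast_add, Nat.cast_one]
      ring

theorem residue_derivative (f : ℂ⸨X⸩) : (derivative ℂ f).coeff (-1) = 0 := by
  rw [coeff_derivative]
  simp

theorem derivative_eval₂ (W : ℂ⸨X⸩) (p : Polynomial ℂ) :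
    derivative ℂ (p.eval₂ HahnSeries.C W) =
      p.derivative.eval₂ HahnSeries.C W * derivative ℂ W := by
  induction p using Polynomial.induction_on' with
  | add p q hp hq =>
    rw [Polynomial.eval₂_add, map_add, hp, hq, map_add, Polynomial.eval₂_add, add_mul]
  | monomial n a =>
    rw [Polynomial.derivative_monomial, Polynomial.eval₂_monomial, Polynomial.eval₂_monomial,
      derivative_C_mul, derivative_pow, map_mul, map_natCast]
    ring

/-- With `q` an antiderivative of `p`, the product is the derivative of `q(W)`, and derivatives have
no residue. -/
theorem residue_eval₂_mul_derivative (W : ℂ⸨X⸩) (p : Polynomial ℂ) :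
    (p.eval₂ HahnSeries.C W * derivative ℂ W).coeff (-1) = 0 := by
  obtain ⟨q, rfl⟩ : ∃ q : Polynomial ℂ, q.derivative = p := by
    induction p using Polynomial.induction_on' with
    | add p q hp hq =>
      obtain ⟨P, rfl⟩ := hp
      obtain ⟨Q, rfl⟩ := hq
      exact ⟨P + Q, map_add _ _ _⟩
    | monomial n a =>
      refine ⟨Polynomial.monomial (n + 1) (a / (n + 1)), ?_⟩
      rw [Polynomial.derivative_monomial]
      have : (n : ℂ) + 1 ≠ 0 := by exact_mod_cast n.succ_ne_zero
      congr 1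
      push_cast
      field_simp
  rw [← derivative_eval₂, residue_derivative]

/-! ### Weierstrass's equation and the lattice expansions -/

/-- If `W` satisfies Weierstrass's differential equation, the second derivative of `W` is
`6 W² - a / 2`. -/
theorem derivative_derivative_of_sq_eq {W : ℂ⸨X⸩} {a b : ℂ} (h0 : derivative ℂ W ≠ 0)
    (h : derivative ℂ W ^ 2 = 4 * W ^ 3 - HahnSeries.C a * W - HahnSeries.C b) :
    2 * derivative ℂ (derivative ℂ W) = 12 * W ^ 2 - HahnSeries.C a := by
  have h1 := congrArg (derivative ℂ) h
  have h4 : (4 : ℂ⸨X⸩) = HahnSeries.C (4 : ℂ) := (map_ofNat HahnSeries.C 4).symm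
  have hb : derivative ℂ (HahnSeries.C b : ℂ⸨X⸩) = 0 := by
    have := derivative_C_mul b 1
    have h1 := derivative_pow (1 : ℂ⸨X⸩) 0
    rw [pow_zero] at h1
    rw [mul_one, h1] at this
    rw [this]
    simp
  rw [h4, map_sub, map_sub, derivative_C_mul, derivative_C_mul, derivative_pow, derivative_pow,
    hb, ← h4] at h1
  apply mul_right_cancel₀ h0
  norm_num only [Nat.cast_ofNat, pow_one] at h1
  linear_combination h1

theorem derivative_eval₂_mul_derivative {W : ℂ⸨X⸩} {a b : ℂ} (h0 : derivative ℂ W ≠ 0)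
    (h : derivative ℂ W ^ 2 = 4 * W ^ 3 - HahnSeries.C a * W - HahnSeries.C b)
    (p : Polynomial ℂ) :
    ∃ q : Polynomial ℂ,
      derivative ℂ (p.eval₂ HahnSeries.C W * derivative ℂ W) = q.eval₂ HahnSeries.C W := by
  have h2 := derivative_derivative_of_sq_eq h0 h
  have h3 : derivative ℂ (derivative ℂ W) = 6 * W ^ 2 - HahnSeries.C (a / 2) := by
    have h20 : (2 : ℂ⸨X⸩) = HahnSeries.C (2 : ℂ) := (map_ofNat HahnSeries.C 2).symm
    have : (HahnSeries.C a : ℂ⸨X⸩) = 2 * HahnSeries.C (a / 2) := by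
      rw [h20, ← map_mul]
      congr 1
      ring
    rw [this] at h2
    have h2ne : (2 : ℂ⸨X⸩) ≠ 0 := by
      rw [h20]
      exact (map_ne_zero _).mpr two_ne_zero
    apply mul_left_cancel₀ h2ne
    linear_combination h2
  -- This is `p'(W) W'^2 + p(W) W''` with both `W'^2` and `W''` written as polynomials in `W`.
  refine ⟨p.derivative * (4 * .X ^ 3 - .C a * .X - .C b) + p * (6 * .X ^ 2 - .C (a / 2)), ?_⟩
  rw [derivative_mul, derivative_eval₂, h3]
  simp only [Polynomial.eval₂_add, Polynomial.eval₂_mul, Polynomial.eval₂_sub,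
    Polynomial.eval₂_pow, Polynomial.eval₂_X, Polynomial.eval₂_C, Polynomial.eval₂_ofNat, ← h]
  ring

/-- The formal Laurent expansion at `0` of `∑ (X + l)^(-(m + 1))`, the sum running over a lattice
whose `k`-th power sum `∑ l^(-k)` is `g k`. -/
noncomputable def latticeExpansion (g : ℕ → ℂ) (m : ℕ) : ℂ⸨X⸩ :=
  single (-(m + 1 : ℤ)) 1 +
    ((PowerSeries.mk fun i => (-1) ^ i * ((i + m).choose m : ℂ) * g (i + m + 1) : ℂ⟦X⟧) : ℂ⸨X⸩)

theorem derivative_latticeExpansion (g : ℕ → ℂ) (m : ℕ) :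
    derivative ℂ (latticeExpansion g m) =
      HahnSeries.C (-(m + 1 : ℂ)) * latticeExpansion g (m + 1) := by
  have h : (PowerSeries.derivative ℂ
      (PowerSeries.mk fun i => (-1) ^ i * ((i + m).choose m : ℂ) * g (i + m + 1)) : ℂ⟦X⟧) =
      PowerSeries.C (-(m + 1 : ℂ)) * PowerSeries.mk fun i =>
        (-1) ^ i * ((i + (m + 1)).choose (m + 1) : ℂ) * g (i + (m + 1) + 1) := by
    ext i
    rw [PowerSeries.coeff_derivative, PowerSeries.coeff_C_mul, PowerSeries.coeff_mk,
      PowerSeries.coeff_mk]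
    have h1 := Nat.choose_succ_right_eq (i + m + 1) m
    rw [show i + m + 1 - m = i + 1 by lia] at h1
    have h2 : ((i + m + 1).choose (m + 1) : ℂ) * (m + 1) = (i + m + 1).choose m * (i + 1) := by
      exact_mod_cast h1
    rw [show i + 1 + m = i + m + 1 by ring, ← add_assoc, pow_succ]
    linear_combination (-1) ^ i * g (i + m + 1 + 1) * h2
  rw [latticeExpansion, latticeExpansion, map_add, derivative_coe, h, mul_add,
    PowerSeries.coe_mul, PowerSeries.coe_C]
  congr 1
  ext n
  rw [coeff_derivative, coeff_C_mul, HahnSeries.coeff_single, HahnSeries.coeff_single]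
  by_cases hn : n = -((m + 1 : ℕ) + 1 : ℤ)
  · subst hn
    push_cast
    simp
  · rw [if_neg (by push_cast at hn; lia), if_neg hn]
    simp

theorem latticeExpansion_succ (g : ℕ → ℂ) (m : ℕ) :
    latticeExpansion g (m + 1) =
      HahnSeries.C (-(m + 1 : ℂ)⁻¹) * derivative ℂ (latticeExpansion g m) := by
  have : (m : ℂ) + 1 ≠ 0 := by exact_mod_cast m.succ_ne_zero
  rw [derivative_latticeExpansion, ← mul_assoc, ← map_mul, neg_mul_neg, inv_mul_cancel₀ this,
    map_one, one_mul]

theorem derivative_latticeExpansion_one_ne_zero (g : ℕ → ℂ) :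
    derivative ℂ (latticeExpansion g 1) ≠ 0 := by
  intro h
  have := congrArg (fun f : ℂ⸨X⸩ => f.coeff (-3)) h
  beta_reduce at this
  rw [coeff_derivative, latticeExpansion, HahnSeries.coeff_add, HahnSeries.coeff_single,
    if_pos (by norm_num), PowerSeries.coeff_coe, if_pos (by decide), HahnSeries.coeff_zero] at this
  norm_num at this

/-- Each step of the induction differentiates twice: `p(W) W'` becomes some `q(W)`, then `q'(W) W'`.
-/
theorem exists_latticeExpansion_even {g : ℕ → ℂ} {a b : ℂ}
    (h : derivative ℂ (latticeExpansion g 1) ^ 2 = 4 * latticeExpansion g 1 ^ 3 -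
      HahnSeries.C a * latticeExpansion g 1 - HahnSeries.C b) (j : ℕ) :
    ∃ p : Polynomial ℂ, latticeExpansion g (2 * j + 2) =
      p.eval₂ HahnSeries.C (latticeExpansion g 1) * derivative ℂ (latticeExpansion g 1) := by
  induction j with
  | zero =>
    refine ⟨.C (-((1 : ℕ) + 1 : ℂ)⁻¹), ?_⟩
    rw [Polynomial.eval₂_C]
    exact latticeExpansion_succ g 1
  | succ j ih =>
    obtain ⟨p, hp⟩ := ih
    obtain ⟨q, hq⟩ :=
      derivative_eval₂_mul_derivative (derivative_latticeExpansion_one_ne_zero g) h p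
    rw [show 2 * (j + 1) + 2 = 2 * j + 2 + 1 + 1 by ring, latticeExpansion_succ,
      latticeExpansion_succ, hp, hq, derivative_C_mul, derivative_eval₂]
    refine ⟨.C (-((2 * j + 2 + 1 : ℕ) + 1 : ℂ)⁻¹) * (.C (-((2 * j + 2 : ℕ) + 1 : ℂ)⁻¹) *
      q.derivative), ?_⟩
    rw [Polynomial.eval₂_mul, Polynomial.eval₂_mul, Polynomial.eval₂_C, Polynomial.eval₂_C]
    ring

/-- Each factor contributes one `W'`; two of the three are absorbed by `W'^2 = 4 W^3 - a W - b`,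
leaving a polynomial in `W` times `W'`. -/
theorem residue_latticeExpansion_mul {g : ℕ → ℂ} {a b : ℂ}
    (h : derivative ℂ (latticeExpansion g 1) ^ 2 = 4 * latticeExpansion g 1 ^ 3 -
      HahnSeries.C a * latticeExpansion g 1 - HahnSeries.C b) (i j k : ℕ) :
    (latticeExpansion g (2 * i + 2) * latticeExpansion g (2 * j + 2) *
      latticeExpansion g (2 * k + 2)).coeff (-1) = 0 := by
  obtain ⟨p, hp⟩ := exists_latticeExpansion_even h i
  obtain ⟨q, hq⟩ := exists_latticeExpansion_even h j
  obtain ⟨r, hr⟩ := exists_latticeExpansion_even h k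
  convert residue_eval₂_mul_derivative (latticeExpansion g 1)
    (p * q * r * (4 * .X ^ 3 - .C a * .X - .C b)) using 2
  rw [hp, hq, hr]
  simp only [Polynomial.eval₂_mul, Polynomial.eval₂_sub,
    Polynomial.eval₂_pow, Polynomial.eval₂_X, Polynomial.eval₂_C, Polynomial.eval₂_ofNat, ← h]
  ring

end LaurentSeries

/-! ### Taylor series of analytic functions -/

/-- The Taylor series at `0` of a function of one complex variable. -/
noncomputable def taylorSeries (f : ℂ → ℂ) : ℂ⟦X⟧ :=
  PowerSeries.mk fun n => iteratedDeriv n f 0 / n.factorial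

namespace taylorSeries

theorem coeff (f : ℂ → ℂ) (n : ℕ) :
    PowerSeries.coeff n (taylorSeries f) = iteratedDeriv n f 0 / n.factorial :=
  PowerSeries.coeff_mk _ _

theorem congr {f g : ℂ → ℂ} (h : f =ᶠ[nhds 0] g) : taylorSeries f = taylorSeries g := by
  ext n
  rw [coeff, coeff, h.iteratedDeriv_eq]

theorem add {f g : ℂ → ℂ} (hf : AnalyticAt ℂ f 0) (hg : AnalyticAt ℂ g 0) :
    taylorSeries (f + g) = taylorSeries f + taylorSeries g := by
  ext n
  rw [map_add, coeff, coeff, coeff, iteratedDeriv_add hf.contDiffAt hg.contDiffAt, add_div]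

theorem mul {f g : ℂ → ℂ} (hf : AnalyticAt ℂ f 0) (hg : AnalyticAt ℂ g 0) :
    taylorSeries (f * g) = taylorSeries f * taylorSeries g := by
  ext n
  rw [PowerSeries.coeff_mul, coeff, iteratedDeriv_mul hf.contDiffAt hg.contDiffAt,
    Finset.Nat.sum_antidiagonal_eq_sum_range_succ_mk, Finset.sum_div]
  refine Finset.sum_congr rfl fun i hi => ?_
  have hi : i ≤ n := Nat.lt_succ_iff.mp (Finset.mem_range.mp hi)
  rw [coeff, coeff, Nat.cast_choose ℂ hi]
  have h1 : (n.factorial : ℂ) ≠ 0 := by exact_mod_cast n.factorial_ne_zero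
  have h2 : (i.factorial : ℂ) ≠ 0 := by exact_mod_cast i.factorial_ne_zero
  have h3 : ((n - i).factorial : ℂ) ≠ 0 := by exact_mod_cast (n - i).factorial_ne_zero
  field_simp

theorem const (c : ℂ) : taylorSeries (fun _ => c) = PowerSeries.C c := by
  ext n
  rw [coeff, iteratedDeriv_const, PowerSeries.coeff_C]
  split_ifs with h <;> simp [h]

theorem pow {f : ℂ → ℂ} (hf : AnalyticAt ℂ f 0) (k : ℕ) :
    taylorSeries (f ^ k) = taylorSeries f ^ k := by
  induction k with
  | zero =>
    rw [pow_zero, pow_zero]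
    exact (const 1).trans (map_one _)
  | succ k ih => rw [pow_succ, pow_succ, mul (hf.pow k) hf, ih]

theorem id : taylorSeries (fun z => z) = PowerSeries.X := by
  ext n
  rw [coeff, PowerSeries.coeff_X]
  rcases n with _ | _ | n
  · simp
  · simp
  · rw [iteratedDeriv_succ']
    simp [iteratedDeriv_const]

end taylorSeries

/-! ### The differential equation of `℘` as a power series identity -/

namespace PeriodPair

variable (L : PeriodPair)

theorem coeff_taylorSeries_weierstrassPExcept (n : ℕ) :
    PowerSeries.coeff n (taylorSeries (L.weierstrassPExcept 0)) =
      if n = 0 then 0 else (n + 1) * L.G (n + 2) := by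
  rw [taylorSeries.coeff, iteratedDeriv_weierstrassPExcept_self, sumInvPow_zero,
    weierstrassPExcept_zero]
  have : (n.factorial : ℂ) ≠ 0 := by exact_mod_cast n.factorial_ne_zero
  split_ifs
  · simp
  · rw [Nat.factorial_succ]
    push_cast
    field_simp

theorem taylorSeries_derivWeierstrassPExcept :
    taylorSeries (L.derivWeierstrassPExcept 0) =
      PowerSeries.derivative ℂ (taylorSeries (L.weierstrassPExcept 0)) := by
  ext n
  rw [PowerSeries.coeff_derivative, coeff_taylorSeries_weierstrassPExcept, if_neg (by simp),
    taylorSeries.coeff, iteratedDeriv_derivWeierstrassPExcept_self, sumInvPow_zero]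
  have : (n.factorial : ℂ) ≠ 0 := by exact_mod_cast n.factorial_ne_zero
  rw [Nat.factorial_succ, Nat.factorial_succ]
  push_cast
  field_simp

/-- Weierstrass's equation multiplied by `z^6`: the poles are cleared, and the identity extends to
`z = 0`, where both sides are `4`. -/
theorem derivWeierstrassPExcept_sq_eventuallyEq :
    (fun z => (z ^ 3 * L.derivWeierstrassPExcept 0 z + -2) ^ 2 +
        (L.g₂ * (z ^ 4 * (z ^ 2 * L.weierstrassPExcept 0 z + 1)) + L.g₃ * z ^ 6)) =ᶠ[nhds 0]
      fun z => 4 * (z ^ 2 * L.weierstrassPExcept 0 z + 1) ^ 3 := by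
  filter_upwards [L.compl_lattice_sdiff_singleton_mem_nhds 0] with z hz
  by_cases hz0 : z = 0
  · simp [hz0]
    norm_num
  replace hz : z ∉ L.lattice := by simp_all
  have h := L.derivWeierstrassP_sq z hz
  have h1 := L.derivWeierstrassPExcept_def 0 z
  have h2 := L.weierstrassPExcept_def 0 z
  simp only [ZeroMemClass.coe_zero, sub_zero] at h1 h2
  rw [h1, h2]
  field_simp
  linear_combination z ^ 6 * h

theorem taylorSeries_derivWeierstrassPExcept_sq :
    (PowerSeries.X ^ 3 * PowerSeries.derivative ℂ (taylorSeries (L.weierstrassPExcept 0)) +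
        PowerSeries.C (-2)) ^ 2 +
        (PowerSeries.C L.g₂ * (PowerSeries.X ^ 4 *
          (PowerSeries.X ^ 2 * taylorSeries (L.weierstrassPExcept 0) + PowerSeries.C 1)) +
          PowerSeries.C L.g₃ * PowerSeries.X ^ 6) =
      PowerSeries.C 4 * (PowerSeries.X ^ 2 * taylorSeries (L.weierstrassPExcept 0) +
        PowerSeries.C 1) ^ 3 := by
  have hw : AnalyticAt ℂ (L.weierstrassPExcept 0) 0 := L.analyticAt_weierstrassPExcept 0
  have hu : AnalyticAt ℂ (L.derivWeierstrassPExcept 0) 0 := L.analyticAt_derivWeierstrassPExcept 0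
  have hz : AnalyticAt ℂ (fun z : ℂ => z) 0 := analyticAt_id
  have hc (c : ℂ) : AnalyticAt ℂ (fun _ : ℂ => c) 0 := analyticAt_const
  have h1 := ((hz.pow 2).mul hw).add (hc 1)
  have h2 := ((hz.pow 3).mul hu).add (hc (-2))
  have h3 := (hc L.g₂).mul ((hz.pow 4).mul h1)
  have h4 := (hc L.g₃).mul (hz.pow 6)
  have h := taylorSeries.congr L.derivWeierstrassPExcept_sq_eventuallyEq
  rw [← taylorSeries_derivWeierstrassPExcept, ← taylorSeries.id, ← taylorSeries.const,
    ← taylorSeries.const, ← taylorSeries.const, ← taylorSeries.const, ← taylorSeries.const,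
    ← taylorSeries.pow hz, ← taylorSeries.pow hz, ← taylorSeries.pow hz, ← taylorSeries.pow hz,
    ← taylorSeries.mul (hz.pow 2) hw, ← taylorSeries.mul (hz.pow 3) hu,
    ← taylorSeries.add ((hz.pow 2).mul hw) (hc 1),
    ← taylorSeries.add ((hz.pow 3).mul hu) (hc (-2)),
    ← taylorSeries.mul (hz.pow 4) h1, ← taylorSeries.mul (hc _) ((hz.pow 4).mul h1),
    ← taylorSeries.mul (hc _) (hz.pow 6), ← taylorSeries.pow h1, ← taylorSeries.pow h2,
    ← taylorSeries.add h3 h4, ← taylorSeries.add (h2.pow 2) (h3.add h4),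
    ← taylorSeries.mul (hc 4) (h1.pow 3)]
  exact h

end PeriodPair

/-! ### Eisenstein series as lattice sums -/

/-- The period pair `(τ, 1)`. -/
noncomputable def UpperHalfPlane.periodPair (τ : ℍ) : PeriodPair where
  ω₁ := τ
  ω₂ := 1
  indep := by
    rw [LinearIndependent.pair_iff]
    intro s t h
    have him := congrArg Complex.im h
    have hre := congrArg Complex.re h
    simp at him hre
    have hs : s = 0 := him.resolve_right τ.im_pos.ne'
    subst hs
    simpa using hre

theorem UpperHalfPlane.G_periodPair (τ : ℍ) {k : ℕ} (hk : k ≠ 0) :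
    τ.periodPair.G k = eisensteinG k τ := by
  rw [PeriodPair.G, ← τ.periodPair.latticeEquivProd.symm.toEquiv.tsum_eq, eisensteinG]
  -- The lattice sum includes the origin, whose term is `0` since `0⁻¹ = 0` and `k ≠ 0`.
  have h := tsum_subtype_eq_of_support_subset (s := {v : ℤ × ℤ | v ≠ (0, 0)})
    (f := fun v : ℤ × ℤ => ((v.1 : ℂ) * (τ : ℂ) + (v.2 : ℂ)) ^ (-(k : ℤ))) (by
      intro v hv hv0
      rw [hv0] at hv
      exact hv (by simp [hk]))
  refine Eq.trans (tsum_congr fun v => ?_) h.symm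
  have := τ.periodPair.latticeEquiv_symm_apply v
  simp only [LinearEquiv.coe_toEquiv, this, zpow_neg, zpow_natCast]
  simp [UpperHalfPlane.periodPair]

/-! ### Extracting the residue -/

namespace LaurentSeries

/-- Of the expanded product, only the terms mixing poles with regular parts contribute: the pure
pole has order `2a + b + 3 > 1`, and `F * F * G` is regular. -/
theorem coeff_single_add_sq_mul_single_add (F G : ℂ⟦X⟧) (a b : ℕ) :
    ((single (-(a + 1 : ℤ)) 1 + (F : ℂ⸨X⸩)) * (single (-(a + 1 : ℤ)) 1 + (F : ℂ⸨X⸩)) *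
        (single (-(b + 1 : ℤ)) 1 + (G : ℂ⸨X⸩))).coeff (-1) =
      PowerSeries.coeff (2 * a + 1) G + 2 * PowerSeries.coeff (a + b + 1) F +
        PowerSeries.coeff b (F * F) + 2 * PowerSeries.coeff a (F * G) := by
  have key : (single (-(a + 1 : ℤ)) 1 + (F : ℂ⸨X⸩)) * (single (-(a + 1 : ℤ)) 1 + (F : ℂ⸨X⸩)) *
      (single (-(b + 1 : ℤ)) 1 + (G : ℂ⸨X⸩)) =
      single (-(2 * a + b + 3 : ℤ)) 1 + single (-(2 * a + 2 : ℤ)) 1 * (G : ℂ⸨X⸩) +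
        (single (-(a + b + 2 : ℤ)) 1 * (F : ℂ⸨X⸩) + single (-(a + b + 2 : ℤ)) 1 * (F : ℂ⸨X⸩)) +
        single (-(b + 1 : ℤ)) 1 * ((F * F : ℂ⟦X⟧) : ℂ⸨X⸩) +
        (single (-(a + 1 : ℤ)) 1 * ((F * G : ℂ⟦X⟧) : ℂ⸨X⸩) +
          single (-(a + 1 : ℤ)) 1 * ((F * G : ℂ⟦X⟧) : ℂ⸨X⸩)) +
        ((F * F * G : ℂ⟦X⟧) : ℂ⸨X⸩) := by
    have h1 : (single (-(2 * a + 2 : ℤ)) 1 : ℂ⸨X⸩) =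
        single (-(a + 1 : ℤ)) 1 * single (-(a + 1 : ℤ)) 1 := by
      rw [HahnSeries.single_mul_single, mul_one]
      congr 2
      ring
    have h2 : (single (-(a + b + 2 : ℤ)) 1 : ℂ⸨X⸩) =
        single (-(a + 1 : ℤ)) 1 * single (-(b + 1 : ℤ)) 1 := by
      rw [HahnSeries.single_mul_single, mul_one]
      congr 2
    have h3 : (single (-(2 * a + b + 3 : ℤ)) 1 : ℂ⸨X⸩) =
        single (-(2 * a + 2 : ℤ)) 1 * single (-(b + 1 : ℤ)) 1 := by
      rw [HahnSeries.single_mul_single, mul_one]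
      congr 2
      ring
    rw [h3, h1, h2]
    simp only [PowerSeries.coe_mul]
    ring
  have hc (H : ℂ⟦X⟧) (k : ℤ) (m : ℕ) (h : -1 - k = m) :
      (single k 1 * (H : ℂ⸨X⸩)).coeff (-1) = PowerSeries.coeff m H := by
    rw [HahnSeries.coeff_single_mul, h, coeff_coe_powerSeries, one_mul]
  rw [key]
  simp only [HahnSeries.coeff_add]
  rw [hc G _ (2 * a + 1) (by push_cast; ring), hc F _ (a + b + 1) (by push_cast; ring),
    hc (F * F) _ b (by ring), hc (F * G) _ a (by ring), HahnSeries.coeff_single,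
    if_neg (by lia), PowerSeries.coeff_coe (F * F * G), if_pos (by decide)]
  ring

end LaurentSeries

theorem Finset.sum_range_two_mul_add_one_of_even_eq_zero {M : Type*} [AddCommMonoid M] (f : ℕ → M)
    (hf : ∀ i, Even i → f i = 0) (n : ℕ) :
    ∑ i ∈ Finset.range (2 * n + 1), f i = ∑ k ∈ Finset.Icc 1 n, f (2 * k - 1) := by
  induction n with
  | zero => simp [hf 0]
  | succ n ih =>
    rw [show 2 * (n + 1) + 1 = 2 * n + 1 + 1 + 1 by ring, Finset.sum_range_succ,
      Finset.sum_range_succ, ih, hf (2 * n + 1 + 1) (by grind), add_zero,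
      Finset.sum_Icc_succ_top (by lia), show 2 * (n + 1) - 1 = 2 * n + 1 by lia]

open LaurentSeries in
theorem choose_mul_eq_sum_of_weierstrass {g : ℕ → ℂ} {a b : ℂ} (hodd : ∀ k, Odd k → g k = 0)
    (h : derivative ℂ (latticeExpansion g 1) ^ 2 = 4 * latticeExpansion g 1 ^ 3 -
      HahnSeries.C a * latticeExpansion g 1 - HahnSeries.C b) {n : ℕ} (hn : 2 ≤ n) :
    ((6 * n + 1).choose (2 * n) : ℂ) * g (6 * n) =
      ∑ k ∈ Finset.Icc 1 n,
        (((2 * n + 2 * k - 1).choose (2 * n) : ℂ) * ((4 * n - 2 * k - 1).choose (2 * n) : ℂ) +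
          2 * ((2 * n + 2 * k - 1).choose (2 * n) : ℂ) *
            ((4 * n - 2 * k - 1).choose (2 * n - 2) : ℂ)) *
        (g (2 * n + 2 * k) * g (4 * n - 2 * k)) := by
  obtain ⟨m, rfl⟩ : ∃ m, n = m + 2 := ⟨n - 2, by lia⟩
  -- The expansions have indices `2n`, `2n`, `2n - 2`, that is, exponents `2n + 1`, `2n + 1`, `2n -
  -- 1`; `n ≥ 2` keeps the last at least `3`.
  have hres := residue_latticeExpansion_mul h (m + 1) (m + 1) m
  rw [latticeExpansion, latticeExpansion, coeff_single_add_sq_mul_single_add,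
    PowerSeries.coeff_mul, PowerSeries.coeff_mul,
    Finset.Nat.sum_antidiagonal_eq_sum_range_succ_mk,
    Finset.Nat.sum_antidiagonal_eq_sum_range_succ_mk] at hres
  simp only [PowerSeries.coeff_mk] at hres
  -- Terms with even `i` carry a lattice sum of odd weight and vanish; the others are indexed by `i
  -- = 2k - 1`.
  rw [show (2 * m + 2).succ = 2 * (m + 1) + 1 by lia,
    show (2 * (m + 1) + 2).succ = 2 * (m + 2) + 1 by lia,
    Finset.sum_range_two_mul_add_one_of_even_eq_zero _ (fun i hi => by
      rw [hodd (i + (2 * (m + 1) + 2) + 1) (by grind)]; ring),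
    Finset.sum_range_two_mul_add_one_of_even_eq_zero _ (fun i hi => by
      rw [hodd (i + (2 * (m + 1) + 2) + 1) (by grind)]; ring)] at hres
  have hsq : ∑ k ∈ Finset.Icc 1 (m + 1),
      (-1) ^ (2 * k - 1) * ((2 * k - 1 + (2 * (m + 1) + 2)).choose (2 * (m + 1) + 2) : ℂ) *
        g (2 * k - 1 + (2 * (m + 1) + 2) + 1) *
      ((-1) ^ (2 * m + 2 - (2 * k - 1)) *
        ((2 * m + 2 - (2 * k - 1) + (2 * (m + 1) + 2)).choose (2 * (m + 1) + 2) : ℂ) *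
        g (2 * m + 2 - (2 * k - 1) + (2 * (m + 1) + 2) + 1)) =
      ∑ k ∈ Finset.Icc 1 (m + 2),
        ((2 * (m + 2) + 2 * k - 1).choose (2 * (m + 2)) : ℂ) *
          ((4 * (m + 2) - 2 * k - 1).choose (2 * (m + 2)) : ℂ) *
          (g (2 * (m + 2) + 2 * k) * g (4 * (m + 2) - 2 * k)) := by
    -- The square only yields `k ≤ n - 1`; the term `k = n` is free because `(2n - 1).choose (2n) =
    -- 0`.
    rw [Finset.sum_Icc_succ_top (by lia : 1 ≤ m + 1 + 1),
      Nat.choose_eq_zero_of_lt (show 4 * (m + 2) - 2 * (m + 1 + 1) - 1 < 2 * (m + 2) by lia),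
      Nat.cast_zero, mul_zero, zero_mul, add_zero]
    refine Finset.sum_congr rfl fun k hk => ?_
    rw [Finset.mem_Icc] at hk
    rw [Odd.neg_one_pow (by grind : Odd (2 * k - 1)),
      Odd.neg_one_pow (by grind : Odd (2 * m + 2 - (2 * k - 1))),
      show 2 * k - 1 + (2 * (m + 1) + 2) + 1 = 2 * (m + 2) + 2 * k by lia,
      show 2 * k - 1 + (2 * (m + 1) + 2) = 2 * (m + 2) + 2 * k - 1 by lia,
      show 2 * m + 2 - (2 * k - 1) + (2 * (m + 1) + 2) + 1 = 4 * (m + 2) - 2 * k by lia,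
      show 2 * m + 2 - (2 * k - 1) + (2 * (m + 1) + 2) = 4 * (m + 2) - 2 * k - 1 by lia,
      show 2 * (m + 1) + 2 = 2 * (m + 2) by lia]
    ring
  have hmix : ∑ k ∈ Finset.Icc 1 (m + 2),
      (-1) ^ (2 * k - 1) * ((2 * k - 1 + (2 * (m + 1) + 2)).choose (2 * (m + 1) + 2) : ℂ) *
        g (2 * k - 1 + (2 * (m + 1) + 2) + 1) *
      ((-1) ^ (2 * (m + 1) + 2 - (2 * k - 1)) *
        ((2 * (m + 1) + 2 - (2 * k - 1) + (2 * m + 2)).choose (2 * m + 2) : ℂ) *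
        g (2 * (m + 1) + 2 - (2 * k - 1) + (2 * m + 2) + 1)) =
      ∑ k ∈ Finset.Icc 1 (m + 2),
        ((2 * (m + 2) + 2 * k - 1).choose (2 * (m + 2)) : ℂ) *
          ((4 * (m + 2) - 2 * k - 1).choose (2 * (m + 2) - 2) : ℂ) *
          (g (2 * (m + 2) + 2 * k) * g (4 * (m + 2) - 2 * k)) := by
    refine Finset.sum_congr rfl fun k hk => ?_
    rw [Finset.mem_Icc] at hk
    rw [Odd.neg_one_pow (by grind : Odd (2 * k - 1)),
      Odd.neg_one_pow (by grind : Odd (2 * (m + 1) + 2 - (2 * k - 1))),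
      show 2 * k - 1 + (2 * (m + 1) + 2) + 1 = 2 * (m + 2) + 2 * k by lia,
      show 2 * k - 1 + (2 * (m + 1) + 2) = 2 * (m + 2) + 2 * k - 1 by lia,
      show 2 * (m + 1) + 2 - (2 * k - 1) + (2 * m + 2) + 1 = 4 * (m + 2) - 2 * k by lia,
      show 2 * (m + 1) + 2 - (2 * k - 1) + (2 * m + 2) = 4 * (m + 2) - 2 * k - 1 by lia,
      show 2 * (m + 1) + 2 = 2 * (m + 2) by lia, show 2 * m + 2 = 2 * (m + 2) - 2 by lia]
    ring
  rw [hsq, hmix, Odd.neg_one_pow (by grind : Odd (2 * (2 * (m + 1) + 2) + 1)),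
    Odd.neg_one_pow (by grind : Odd (2 * (m + 1) + 2 + (2 * m + 2) + 1)),
    show 2 * (2 * (m + 1) + 2) + 1 + (2 * m + 2) + 1 = 6 * (m + 2) by lia,
    show 2 * (m + 1) + 2 + (2 * m + 2) + 1 + (2 * (m + 1) + 2) + 1 = 6 * (m + 2) by lia,
    show 2 * (2 * (m + 1) + 2) + 1 + (2 * m + 2) = 6 * m + 11 by lia,
    show 2 * (m + 1) + 2 + (2 * m + 2) + 1 + (2 * (m + 1) + 2) = 6 * m + 11 by lia] at hres
  -- Pascal's rule twice, then `C(6n-1, 2n) = 2 C(6n-1, 2n-1)`, which holds because `(6n-1) -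
  -- (2n-1)` is twice `2n`.
  have hchoose : ((6 * (m + 2) + 1).choose (2 * (m + 2)) : ℂ) =
      (6 * m + 11).choose (2 * m + 2) + 2 * (6 * m + 11).choose (2 * (m + 1) + 2) := by
    have h1 : (6 * (m + 2) + 1).choose (2 * (m + 2)) = (6 * m + 11).choose (2 * m + 2) +
        2 * (6 * m + 11).choose (2 * m + 3) + (6 * m + 11).choose (2 * m + 4) := by
      rw [show 6 * (m + 2) + 1 = 6 * m + 12 + 1 by lia, show 2 * (m + 2) = 2 * m + 3 + 1 by lia,
        Nat.choose_succ_succ, Nat.choose_succ_succ' (6 * m + 11) (2 * m + 2),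
        Nat.choose_succ_succ' (6 * m + 11) (2 * m + 3)]
      ring
    have h2 : (6 * m + 11).choose (2 * m + 4) = 2 * (6 * m + 11).choose (2 * m + 3) := by
      have := Nat.choose_succ_right_eq (6 * m + 11) (2 * m + 3)
      rw [show 6 * m + 11 - (2 * m + 3) = 2 * (2 * m + 3 + 1) by lia] at this
      refine Nat.eq_of_mul_eq_mul_right (Nat.succ_pos (2 * m + 3)) ?_
      rw [Nat.succ_eq_add_one]
      linarith
    rw [show 2 * (m + 1) + 2 = 2 * m + 4 by lia]
    exact_mod_cast (by lia : (6 * (m + 2) + 1).choose (2 * (m + 2)) =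
      (6 * m + 11).choose (2 * m + 2) + 2 * (6 * m + 11).choose (2 * m + 4))
  simp only [add_mul, Finset.sum_add_distrib, mul_assoc (2 : ℂ), ← Finset.mul_sum]
  rw [hchoose]
  linear_combination -hres

/-! ### The Laurent expansion of `℘` satisfies Weierstrass's equation -/

namespace PeriodPair

open LaurentSeries

variable (L : PeriodPair)

/-- The lattice sums of a period pair, the sum of weight `2` being replaced by `0`: these are the
coefficients in the Laurent expansion of `℘`. -/
noncomputable def reducedG (k : ℕ) : ℂ := if k = 2 then 0 else L.G k

theorem reducedG_of_odd {k : ℕ} (hk : Odd k) : L.reducedG k = 0 := by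
  rw [reducedG, L.G_eq_zero_of_odd k hk, ite_self]

theorem latticeExpansion_one :
    latticeExpansion L.reducedG 1 =
      single (-2 : ℤ) 1 + ((taylorSeries (L.weierstrassPExcept 0) : ℂ⟦X⟧) : ℂ⸨X⸩) := by
  rw [latticeExpansion]
  congr 2
  ext n
  rw [PowerSeries.coeff_mk, coeff_taylorSeries_weierstrassPExcept, reducedG]
  rcases Nat.even_or_odd n with hn | hn
  · rw [hn.neg_one_pow]
    by_cases h0 : n = 0
    · simp [h0]
    · simp [h0]
  · rw [L.G_eq_zero_of_odd (n + 1 + 1) (by grind)]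
    simp

/-- The power series identity with poles cleared is carried into the field of Laurent series, where
the factor `X^6` can be cancelled. -/
theorem derivative_latticeExpansion_sq :
    derivative ℂ (latticeExpansion L.reducedG 1) ^ 2 = 4 * latticeExpansion L.reducedG 1 ^ 3 -
      HahnSeries.C L.g₂ * latticeExpansion L.reducedG 1 - HahnSeries.C L.g₃ := by
  set A : ℂ⸨X⸩ := ((taylorSeries (L.weierstrassPExcept 0) : ℂ⟦X⟧) : ℂ⸨X⸩) with hA
  set x : ℂ⸨X⸩ := single 1 1 with hx
  set y : ℂ⸨X⸩ := single (-1) 1 with hy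
  have hxy : x * y = 1 := by
    rw [hx, hy, HahnSeries.single_mul_single]
    simp
  have hW : latticeExpansion L.reducedG 1 = y ^ 2 + A := by
    rw [latticeExpansion_one, hy, sq, HahnSeries.single_mul_single, mul_one, hA]
    norm_num
  have hy' : derivative ℂ (y ^ 2) = -2 * y ^ 3 := by
    have : derivative ℂ y = -y ^ 2 := by
      rw [hy, sq, HahnSeries.single_mul_single, mul_one]
      ext n
      rw [coeff_derivative, HahnSeries.coeff_neg, HahnSeries.coeff_single, HahnSeries.coeff_single]
      by_cases hn : n = -1 + -1
      · subst hn
        norm_num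
      · rw [if_neg (by lia), if_neg hn]
        simp
    rw [derivative_pow, this]
    push_cast
    ring
  have h := congrArg (HahnSeries.ofPowerSeries ℤ ℂ) L.taylorSeries_derivWeierstrassPExcept_sq
  simp only [map_add (HahnSeries.ofPowerSeries ℤ ℂ), map_mul (HahnSeries.ofPowerSeries ℤ ℂ),
    map_pow (HahnSeries.ofPowerSeries ℤ ℂ), ← derivative_coe, PowerSeries.coe_C,
    PowerSeries.coe_X] at h
  rw [map_neg, map_ofNat, map_ofNat, map_one HahnSeries.C, ← hA, ← hx] at h
  have h2 : x ^ 2 * A + 1 = x ^ 2 * (y ^ 2 + A) := by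
    linear_combination (-x * y - 1) * hxy
  have h3 : x ^ 3 * derivative ℂ A + -2 = x ^ 3 * (-2 * y ^ 3 + derivative ℂ A) := by
    linear_combination 2 * (x ^ 2 * y ^ 2 + x * y + 1) * hxy
  rw [h2, h3] at h
  rw [hW, map_add, hy']
  have hx0 : x ^ 6 ≠ 0 := pow_ne_zero _ (left_ne_zero_of_mul_eq_one hxy)
  apply mul_left_cancel₀ hx0
  linear_combination h

end PeriodPair

theorem theorem1p2 (n : ℕ) (hn : 2 ≤ n) (τ : ℍ) :
    ((6 * n + 1).choose (2 * n) : ℂ) * eisensteinG (6 * n) τ =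
      ∑ k ∈ Finset.Icc 1 n,
        (((2 * n + 2 * k - 1).choose (2 * n) : ℂ) * ((4 * n - 2 * k - 1).choose (2 * n) : ℂ) +
          2 * ((2 * n + 2 * k - 1).choose (2 * n) : ℂ) *
            ((4 * n - 2 * k - 1).choose (2 * n - 2) : ℂ)) *
        (eisensteinG (2 * n + 2 * k) τ * eisensteinG (4 * n - 2 * k) τ) := by
  have h := choose_mul_eq_sum_of_weierstrass (fun k hk => τ.periodPair.reducedG_of_odd hk)
    τ.periodPair.derivative_latticeExpansion_sq hn
  -- All weights in the identity are at least `2n ≥ 4`, so the convention in weight `2` plays no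
  -- role.
  have hG (k : ℕ) (hk : 2 < k) : τ.periodPair.reducedG k = eisensteinG k τ := by
    rw [PeriodPair.reducedG, if_neg (by lia), τ.G_periodPair (by lia)]
  rw [hG _ (by lia)] at h
  rw [h]
  refine Finset.sum_congr rfl fun k hk => ?_
  rw [Finset.mem_Icc] at hk
  rw [hG _ (by lia), hG _ (by lia)]
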